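/- All rings are commutative with identity. For a ring $A$ let $\mathrm{Reg}(A)$ be its set of regular elements (non-zero-divisors) and $K=\mathrm{Reg}(A)^{-1}A$ its total quotient ring. An overring of $A$ is a ring $B$ with $A\subseteq B\subseteq K$; the ring $A$ is \emph{perinormal} if every overring $B$ of $A$ such that $A\subseteq B$ satisfies going down is flat as an $A$-module. An ideal is \emph{regular} if it contains a regular element, and $A$ is a \emph{Marot ring} if every regular ideal of $A$ is generated by regular elements. For a prime ideal $P$ let $A_{(P)}\subseteq K$ be the fraction ring of $A$ with denominators in $(A\setminus P)\cap \mathrm{Reg}(A)$. Let $H$ be the set of minimal regular primes of $A$, that is, the minimal elements of the set of regular prime ideals. The ring $A$ is a \emph{Krull ring} if (1) $A=\bigcap_{P\in H}A_{(P)}$ (the empty intersection being $K$); (2) each $x\in\mathrm{Reg}(A)$ belongs to only finitely many $P\in H$; (3) for each $P\in H$, $A_{(P)}$ is a discrete (Manis) valuation ring, i.e. there is a surjective map $v:K\to\mathbb{Z}\cup\{\infty\}$ with $v(xy)=v(x)+v(y)$, $v(x+y)\ge\min\{v(x),v(y)\}$, $v(1)=0$, $v(0)=\infty$ and $A_{(P)}=\{x\in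 K\mid v(x)\ge 0\}$. Every Marot ring that is a Krull ring is perinormal. In particular, if $R$ is any Noetherian ring (not necessarily reduced), then the integral closure of $R$ in its total quotient ring is perinormal. -/

import Mathlib

open scoped nonZeroDivisors WithZero

namespace ZeroDivisorRing

/-- An ideal is regular if it contains a regular element (a non-zero-divisor). -/
def IsRegularIdeal {A : Type*} [CommRing A] (I : Ideal A) : Prop :=
  ∃ r ∈ I, r ∈ A⁰

/-- A Marot ring: every regular ideal is generated by its regular elements. -/
def IsMarotRing (A : Type*) [CommRing A] : Prop :=
  ∀ I : Ideal A, IsRegularIdeal I → Ideal.span {r : A | r ∈ I ∧ r ∈ A⁰} = I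

/-- The regular quotient ring `A_(P)`: the fraction ring of `A` with denominators in
`(A - P) ∩ Reg(A)`, as an overring of `A` inside the total quotient ring of `A`. -/
noncomputable def regularQuotientRing (A : Type*) [CommRing A] (P : PrimeSpectrum A) :
    Subalgebra A (FractionRing A) :=
  Localization.subalgebra (FractionRing A) (P.asIdeal.primeCompl ⊓ A⁰) inf_le_right

/-- The minimal regular primes: the minimal elements of the set of regular primes. -/
def minimalRegularPrimes (A : Type*) [CommRing A] : Set (PrimeSpectrum A) :=
  {P | Minimal (fun Q : PrimeSpectrum A => IsRegularIdeal Q.asIdeal) P}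

/-- An overring `B` of `A` is a (Manis) discrete valuation ring: it is the ring of a surjective
valuation `K → ℤ ∪ {∞}` on the total quotient ring `K` of `A`. In Mathlib's multiplicative
convention `∞` is `0 : ℤᵐ⁰` and `v x ≥ 0` reads `v x ≤ 1`. -/
def IsManisDVR {A : Type*} [CommRing A] (B : Subalgebra A (FractionRing A)) : Prop :=
  ∃ v : Valuation (FractionRing A) ℤᵐ⁰, Function.Surjective v ∧ ∀ x, x ∈ B ↔ v x ≤ 1

/-- Krull rings (possibly with zero-divisors). The bottom subalgebra is (the image of) `A`. -/
structure IsKrullRing (A : Type*) [CommRing A] : Prop where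
  iInf_eq_bot : ⨅ P ∈ minimalRegularPrimes A, regularQuotientRing A P = ⊥
  finite_character : ∀ x ∈ A⁰, {P ∈ minimalRegularPrimes A | x ∈ P.asIdeal}.Finite
  isManisDVR : ∀ P ∈ minimalRegularPrimes A, IsManisDVR (regularQuotientRing A P)

/-- A ring `A` is perinormal if every overring of `A` (ring between `A` and its total quotient
ring) which satisfies going down over `A` is flat as an `A`-module. -/
def IsPerinormal (A : Type*) [CommRing A] : Prop :=
  ∀ B : Subalgebra A (FractionRing A), Algebra.HasGoingDown A B → Module.Flat A B

end ZeroDivisorRing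

/-! Write (A : x) for the ideal of a in A with ax in A. If B satisfies going down over A, M is a
prime of B, P = M ∩ A and b ∈ B has (A : b) ⊆ P, suppose some prime Q ⊆ P contains an a with ab = y
∈ A \ Q. Going down puts a prime Q' ⊆ M over Q, and y = ab ∈ Q' ∩ A = Q, a contradiction. So if such
a Q always exists, every b is a fraction over A locally at every M, hence B_M = A_{M ∩ A} and B is
flat (`isPerinormal_of_forall_exists`).

For a Marot Krull ring, Q is a minimal regular prime at which x has a pole, and a comes from an
element of inverse value.

The integral closure of a Noetherian ring R is treated directly, without the Krull property. Take Q
minimal over (A : x). If (A : x)x ⊆ Q, integral closedness forces every polynomial over A vanishing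
at sx, for suitable s ∉ Q, to have all coefficients in Q (`coeff_mem_of_aeval_eq_zero`). But a
descending chain argument over R (`exists_smul_pow_eq_add`) produces such a polynomial with a
coefficient outside Q. -/

open Polynomial

namespace ZeroDivisorRing

/-! ### Flatness and going down -/

/-- An injective extension is flat if every element of `B` is, locally on `B`, a fraction of
elements of `A`. -/
theorem flat_of_forall_exists_mul_mem {A B : Type*} [CommRing A] [CommRing B] [Algebra A B]
    (hinj : Function.Injective (algebraMap A B))
    (h : ∀ (M : Ideal B) [M.IsPrime] (b : B), ∃ s a : A,
      algebraMap A B s ∉ M ∧ algebraMap A B s * b = algebraMap A B a) :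
    Module.Flat A B := by
  refine Module.flat_of_isLocalized_maximal (S := B) B (fun P ↦ Localization.AtPrime P)
    (fun P ↦ Algebra.linearMap B _) fun M hM ↦ ?_
  have hMp := hM.isPrime
  -- The hypothesis says B_M = A_{M ∩ A}.
  have key : IsLocalization (M.under A).primeCompl (Localization.AtPrime M) := by
    refine (isLocalization_iff _ _).mpr ⟨?_, ?_, ?_⟩
    · rintro ⟨s, hs⟩
      rw [IsScalarTower.algebraMap_apply A B (Localization.AtPrime M)]
      exact IsLocalization.map_units (M := M.primeCompl) _ ⟨_, hs⟩
    · intro z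
      obtain ⟨b, ⟨t, ht⟩, rfl⟩ := IsLocalization.exists_mk'_eq M.primeCompl z
      obtain ⟨s, a, hs, ha⟩ := h M b
      obtain ⟨s', a', hs', ha'⟩ := h M t
      have ha'M : algebraMap A B a' ∉ M := by
        rw [← ha']
        exact fun h' ↦ (hMp.mem_or_mem h').elim hs' ht
      -- With b = a/s and t = a'/s', the fraction b/t is s'a/(sa').
      refine ⟨⟨s' * a, ⟨s * a', ?_⟩⟩, ?_⟩
      · change algebraMap A B (s * a') ∉ M
        rw [map_mul]
        exact fun h' ↦ (hMp.mem_or_mem h').elim hs ha'M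
      · have hspec := IsLocalization.mk'_spec (Localization.AtPrime M) b
          (⟨t, ht⟩ : M.primeCompl)
        have hB : algebraMap A B (s * a') * b = algebraMap A B (s' * a) * t := by
          simp only [map_mul, ← ha, ← ha']
          ring
        rw [IsScalarTower.algebraMap_apply A B (Localization.AtPrime M),
          IsScalarTower.algebraMap_apply A B (Localization.AtPrime M) (s' * a)]
        refine (IsLocalization.map_units (Localization.AtPrime M)
          (⟨t, ht⟩ : M.primeCompl)).mul_right_cancel ?_
        rw [mul_right_comm, hspec, mul_comm, ← map_mul, hB, map_mul]
    · intro x y hxy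
      rw [IsScalarTower.algebraMap_apply A B (Localization.AtPrime M),
          IsScalarTower.algebraMap_apply A B (Localization.AtPrime M),
          IsLocalization.eq_iff_exists M.primeCompl] at hxy
      obtain ⟨⟨t, ht⟩, htxy⟩ := hxy
      obtain ⟨s, a, hs, ha⟩ := h M t
      refine ⟨⟨a, ?_⟩, hinj ?_⟩
      · change algebraMap A B a ∉ M
        rw [← ha]
        exact fun h' ↦ (hMp.mem_or_mem h').elim hs ht
      · simp only [map_mul, ← ha]
        simp only at htxy
        linear_combination algebraMap A B s * htxy
  exact IsLocalization.flat _ (M.under A).primeCompl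

/-- An overring criterion for perinormality: it suffices that an element `x` of the total quotient
ring which is not a fraction at `P` maps some element of a smaller prime `Q` out of `Q`. -/
theorem isPerinormal_of_forall_exists {A : Type*} [CommRing A]
    (h : ∀ (P : Ideal A) [P.IsPrime] (x : FractionRing A),
      (∀ s a : A, s • x = algebraMap A _ a → s ∈ P) →
      ∃ Q : Ideal A, Q.IsPrime ∧ Q ≤ P ∧ ∃ a ∈ Q, ∃ y ∉ Q, a • x = algebraMap A _ y) :
    IsPerinormal A := by
  intro B hB
  have hinj : Function.Injective (algebraMap A B) := by
    refine Function.Injective.of_comp (f := algebraMap B (FractionRing A)) ?_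
    rw [← RingHom.coe_comp, ← IsScalarTower.algebraMap_eq]
    exact IsFractionRing.injective A _
  refine flat_of_forall_exists_mul_mem hinj fun M _ b ↦ ?_
  by_contra! hcon
  obtain ⟨Q, hQ, hQP, a, haQ, y, hyQ, hay⟩ := h (M.under A) b.1 fun s a hsa ↦ by
    by_contra hs
    refine hcon s a hs (Subtype.ext ?_)
    rw [← Algebra.smul_def]
    exact hsa
  obtain ⟨Q', -, hQ', ⟨hover⟩⟩ := Ideal.exists_ideal_le_liesOver_of_le (S := B) M hQP
  apply hyQ
  rw [hover, Ideal.mem_comap]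
  have : algebraMap A B y = algebraMap A B a * b := by
    refine Subtype.ext ?_
    rw [← Algebra.smul_def]
    exact hay.symm
  rw [this]
  refine Q'.mul_mem_right _ ?_
  rw [hover] at haQ
  exact haQ

/-! ### Algebraic relations over an integrally closed ring -/

/-- If `A` is integrally closed in `K` and multiplication by `x` only relates elements of `Q`,
then `x` is transcendental modulo `Q`. -/
theorem coeff_mem_of_aeval_eq_zero {A K : Type*} [CommRing A] [CommRing K] [Algebra A K]
    [IsIntegrallyClosedIn A K] {Q : Ideal A} {x : K}
    (hx : ∀ a y : A, a • x = algebraMap A K y → a ∈ Q ∧ y ∈ Q) (f : A[X])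
    (hf : aeval x f = 0) (k : ℕ) : f.coeff k ∈ Q := by
  have hinj : Function.Injective (algebraMap A K) :=
    (isIntegrallyClosedIn_iff.mp ‹_›).1
  obtain ⟨n, hn⟩ : ∃ n, f.natDegree ≤ n := ⟨_, le_rfl⟩
  induction n generalizing f k with
  | zero =>
    rw [natDegree_le_iff_coeff_eq_zero] at hn
    have h0 : f = C (f.coeff 0) := eq_C_of_natDegree_le_zero (natDegree_le_iff_coeff_eq_zero.mpr hn)
    rw [h0, aeval_C] at hf
    have := hinj (hf.trans (map_zero _).symm)
    rw [h0, this]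
    simp
  | succ n ih =>
    rcases hn.lt_or_eq with hlt | heq
    · exact ih f hf k (Nat.lt_succ_iff.mp hlt)
    -- For the leading coefficient l, the element lx is integral, so lx = y ∈ A. Trading l X^(n+1)
    -- for y X^n keeps the root x, lowers the degree bound and changes coefficients only by elements
    -- of Q.
    obtain ⟨y, hy⟩ := (isIntegrallyClosedIn_iff.mp ‹IsIntegrallyClosedIn A K›).2
      (isIntegral_leadingCoeff_smul f x hf)
    obtain ⟨hl, hyQ⟩ := hx _ _ hy.symm
    have hsum : f.eraseLead + C f.leadingCoeff * X ^ (n + 1) = f := by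
      rw [← heq]; exact f.eraseLead_add_C_mul_X_pow
    have h1 : aeval x (f.eraseLead + C y * X ^ n) = 0 := by
      rw [← hsum] at hf
      simp only [map_add, map_mul, aeval_C, map_pow, aeval_X] at hf ⊢
      rw [hy, Algebra.smul_def]
      rw [pow_succ] at hf
      linear_combination hf
    have h2 := ih _ h1 k (by
      refine (natDegree_add_le _ _).trans (max_le ?_ (natDegree_C_mul_X_pow_le _ _))
      have := f.eraseLead_natDegree_le
      omega)
    rw [← hsum]
    simp only [coeff_add, coeff_C_mul, coeff_X_pow] at h2 ⊢
    refine Q.add_mem ?_ (Q.mul_mem_right _ hl)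
    exact (Q.add_mem_iff_left (Q.mul_mem_right _ hyQ)).mp h2

/-! ### Regular quotient rings and their valuations -/

theorem mem_regularQuotientRing_iff {A : Type*} [CommRing A] {P : PrimeSpectrum A}
    {x : FractionRing A} :
    x ∈ regularQuotientRing A P ↔
      ∃ s ∉ P.asIdeal, s ∈ A⁰ ∧ ∃ a : A, s • x = algebraMap A _ a := by
  constructor
  · rintro ⟨a, s, hs, rfl⟩
    refine ⟨s, hs.1, hs.2, a, ?_⟩
    rw [Algebra.smul_def, mul_comm]
    exact IsLocalization.mk'_spec _ a (⟨s, hs.2⟩ : A⁰)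
  · rintro ⟨s, hsP, hs, a, h⟩
    refine ⟨a, s, ⟨hsP, hs⟩, ?_⟩
    rw [IsLocalization.eq_mk'_iff_mul_eq, mul_comm, ← Algebra.smul_def]
    exact h

theorem IsMarotRing.le_of_forall_mem_nonZeroDivisors {A : Type*} [CommRing A] (hA : IsMarotRing A)
    {I J : Ideal A} (hI : IsRegularIdeal I) (h : ∀ r ∈ I, r ∈ A⁰ → r ∈ J) : I ≤ J := by
  rw [← hA I hI, Ideal.span_le]
  exact fun r hr ↦ h r hr.1 hr.2

section Valuation

variable {A : Type*} [CommRing A] {P : PrimeSpectrum A} {v : Valuation (FractionRing A) ℤᵐ⁰}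

theorem valuation_algebraMap_le_one (hv : ∀ x, x ∈ regularQuotientRing A P ↔ v x ≤ 1) (a : A) :
    v (algebraMap A _ a) ≤ 1 :=
  (hv _).mp (Subalgebra.algebraMap_mem _ a)

theorem valuation_eq_one (hv : ∀ x, x ∈ regularQuotientRing A P ↔ v x ≤ 1) {s : A}
    (hs : s ∈ A⁰) (hsP : s ∉ P.asIdeal) : v (algebraMap A _ s) = 1 := by
  obtain ⟨u, hu⟩ := IsLocalization.map_units (FractionRing A) (⟨s, hs⟩ : A⁰)
  have hu : algebraMap A (FractionRing A) s = u := hu.symm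
  have h1 : v (↑u⁻¹ : FractionRing A) ≤ 1 := by
    rw [← hv, mem_regularQuotientRing_iff]
    exact ⟨s, hsP, hs, 1, by rw [Algebra.smul_def, hu, map_one]; simp⟩
  refine le_antisymm (valuation_algebraMap_le_one hv s) ?_
  have : v (algebraMap A _ s) * v (↑u⁻¹ : FractionRing A) = 1 := by
    rw [← map_mul, hu, Units.mul_inv, map_one]
  rw [← this]
  exact mul_le_of_le_one_right' h1

/-- If v(s) were 1, then 1/s would lie in A_(P), say 1/s = a/t with t ∉ P; but t = as ∈ P. -/
theorem valuation_lt_one_of_mem_nonZeroDivisors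
    (hv : ∀ x, x ∈ regularQuotientRing A P ↔ v x ≤ 1) {s : A}
    (hs : s ∈ A⁰) (hsP : s ∈ P.asIdeal) : v (algebraMap A _ s) < 1 := by
  refine lt_of_le_of_ne (valuation_algebraMap_le_one hv s) fun h ↦ ?_
  obtain ⟨u, hu⟩ := IsLocalization.map_units (FractionRing A) (⟨s, hs⟩ : A⁰)
  have hu : algebraMap A (FractionRing A) s = u := hu.symm
  have h1 : v (↑u⁻¹ : FractionRing A) ≤ 1 := by
    have : v (algebraMap A _ s) * v (↑u⁻¹ : FractionRing A) = 1 := by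
      rw [← map_mul, hu, Units.mul_inv, map_one]
    rw [h, one_mul] at this
    exact this.le
  rw [← hv, mem_regularQuotientRing_iff] at h1
  obtain ⟨t, htP, -, a, ha⟩ := h1
  apply htP
  have : t = a * s := by
    apply IsFractionRing.injective A (FractionRing A)
    rw [map_mul, ← ha, hu, Algebra.smul_def, mul_assoc, Units.inv_mul, mul_one]
  rw [this]
  exact P.asIdeal.mul_mem_left _ hsP

/-- In a Marot ring, a regular prime `P` is the center on `A` of the valuation of `A_(P)`. -/
theorem mem_iff_valuation_lt_one (hA : IsMarotRing A) (hP : IsRegularIdeal P.asIdeal)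
    (hv : ∀ x, x ∈ regularQuotientRing A P ↔ v x ≤ 1) (a : A) :
    a ∈ P.asIdeal ↔ v (algebraMap A _ a) < 1 := by
  let J : Ideal A :=
    { carrier := {a | v (algebraMap A _ a) < 1}
      add_mem' := fun {a b} ha hb ↦ by
        simp only [Set.mem_ofPred_eq, map_add] at *
        exact v.map_add_lt ha hb
      zero_mem' := by simp
      smul_mem' := fun c a ha ↦ by
        simp only [Set.mem_ofPred_eq, smul_eq_mul, map_mul] at *
        exact (mul_le_of_le_one_left' (valuation_algebraMap_le_one hv c)).trans_lt ha }
  have hPJ : P.asIdeal ≤ J := hA.le_of_forall_mem_nonZeroDivisors hP fun r hrP hr ↦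
    valuation_lt_one_of_mem_nonZeroDivisors hv hr hrP
  have hJ : IsRegularIdeal J := hP.imp fun r hr ↦ ⟨hPJ hr.1, hr.2⟩
  have hJP : J ≤ P.asIdeal := hA.le_of_forall_mem_nonZeroDivisors hJ fun r hrJ hr ↦ by
    by_contra hrP
    exact (show v (algebraMap A _ r) < 1 from hrJ).ne (valuation_eq_one hv hr hrP)
  exact ⟨fun h ↦ hPJ h, fun h ↦ hJP h⟩

end Valuation

/-! ### Marot Krull rings -/

theorem exists_pow_mul_le_one {c y : ℤᵐ⁰} (hc : c < 1) : ∃ n : ℕ, c ^ n * y ≤ 1 := by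
  rcases eq_or_ne c 0 with rfl | hc0
  · exact ⟨1, by simp⟩
  obtain ⟨n, hn⟩ := MulArchimedean.arch y (one_lt_inv_iff₀.mpr ⟨zero_lt_iff.mpr hc0, hc⟩)
  refine ⟨n, (mul_le_mul_right hn (c ^ n)).trans_eq ?_⟩
  rw [← mul_pow, mul_inv_cancel₀ hc0, one_pow]

/-- Otherwise x has poles only at primes Q not contained in P. These contain the denominator d of x,
so they are finitely many, and at each one a power of a regular element of Q \ P clears the pole.
The product of these multipliers lies outside P and carries x into the intersection of the A_(Q),
which is A. -/
theorem IsKrullRing.exists_minimalRegularPrime_le {A : Type*} [CommRing A] (hM : IsMarotRing A)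
    (hK : IsKrullRing A) {P : Ideal A} [P.IsPrime] {x : FractionRing A}
    (hx : ∀ s a : A, s • x = algebraMap A _ a → s ∈ P) :
    ∃ Q ∈ minimalRegularPrimes A, Q.asIdeal ≤ P ∧ x ∉ regularQuotientRing A Q := by
  classical
  by_contra! hcon
  obtain ⟨c, ⟨d, hd⟩, rfl⟩ := IsLocalization.exists_mk'_eq A⁰ x
  set x := IsLocalization.mk' (FractionRing A) c (⟨d, hd⟩ : A⁰) with hxdef
  have hdx : d • x = algebraMap A _ c := by
    rw [Algebra.smul_def, mul_comm]
    exact IsLocalization.mk'_spec _ c (⟨d, hd⟩ : A⁰)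
  have hfin := hK.finite_character d hd
  have hstep : ∀ Q ∈ minimalRegularPrimes A, ∃ s ∉ P, s • x ∈ regularQuotientRing A Q := by
    intro Q hQ
    by_cases hQx : x ∈ regularQuotientRing A Q
    · exact ⟨1, fun h ↦ Ideal.IsPrime.ne_top ‹_› ((Ideal.eq_top_iff_one _).mpr h), by simpa⟩
    have hQP : ¬ Q.asIdeal ≤ P := fun h ↦ hQx (hcon Q hQ h)
    obtain ⟨s, hsQ, hs, hsP⟩ : ∃ s ∈ Q.asIdeal, s ∈ A⁰ ∧ s ∉ P := by
      by_contra! h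
      exact hQP (hM.le_of_forall_mem_nonZeroDivisors hQ.1 h)
    obtain ⟨v, -, hv⟩ := hK.isManisDVR Q hQ
    obtain ⟨n, hn⟩ := exists_pow_mul_le_one (y := v x)
      (valuation_lt_one_of_mem_nonZeroDivisors hv hs hsQ)
    refine ⟨s ^ n, fun h ↦ hsP (Ideal.IsPrime.mem_of_pow_mem ‹_› _ h), ?_⟩
    rw [hv, Algebra.smul_def, map_mul, map_pow, map_pow]
    exact hn
  choose! s hsP hs using hstep
  have hprod : (∏ Q ∈ hfin.toFinset, s Q) ∉ P := by
    intro h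
    obtain ⟨Q, hQ, hQP⟩ := (Ideal.IsPrime.prod_mem_iff).mp h
    exact hsP Q (hfin.mem_toFinset.mp hQ).1 hQP
  have hmem : (∏ Q ∈ hfin.toFinset, s Q) • x ∈ (⊥ : Subalgebra A (FractionRing A)) := by
    rw [← hK.iInf_eq_bot]
    simp only [Algebra.mem_iInf]
    intro Q hQ
    by_cases hdQ : d ∈ Q.asIdeal
    · rw [← Finset.prod_erase_mul _ _ (hfin.mem_toFinset.mpr ⟨hQ, hdQ⟩), mul_smul]
      exact Subalgebra.smul_mem _ (hs Q hQ) _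
    · exact Subalgebra.smul_mem _ (mem_regularQuotientRing_iff.mpr ⟨d, hdQ, hd, c, hdx⟩) _
  obtain ⟨a, ha⟩ := Algebra.mem_bot.mp hmem
  exact hprod (hx _ a ha.symm)

theorem IsKrullRing.isPerinormal {A : Type*} [CommRing A] (hK : IsKrullRing A)
    (hM : IsMarotRing A) : IsPerinormal A := by
  refine isPerinormal_of_forall_exists fun P _ x hx ↦ ?_
  obtain ⟨Q, hQ, hQP, hxQ⟩ := hK.exists_minimalRegularPrime_le hM hx
  obtain ⟨v, hsurj, hv⟩ := hK.isManisDVR Q hQ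
  have hcenter := mem_iff_valuation_lt_one hM hQ.1 hv
  have hvx : 1 < v x := by simpa [hv] using hxQ
  have hvx0 : v x ≠ 0 := (zero_lt_one.trans hvx).ne'
  -- Here w has positive order at Q and wx has order zero. Writing w = a/s and wx = y/t gives (ta)x
  -- = sy with ta ∈ Q and sy ∉ Q.
  obtain ⟨w, hw⟩ := hsurj (v x)⁻¹
  have hw1 : v w < 1 := by rw [hw]; exact inv_lt_one_of_one_lt₀ hvx
  have hwx : v (w * x) = 1 := by rw [map_mul, hw, inv_mul_cancel₀ hvx0]
  obtain ⟨s, hsQ, hs, a, ha⟩ := mem_regularQuotientRing_iff.mp ((hv _).mpr hw1.le)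
  obtain ⟨t, htQ, ht, y, hy⟩ := mem_regularQuotientRing_iff.mp ((hv _).mpr hwx.le)
  have hvs := valuation_eq_one hv hs hsQ
  have hvt := valuation_eq_one hv ht htQ
  rw [Algebra.smul_def] at ha hy
  refine ⟨Q.asIdeal, Q.isPrime, hQP, t * a, ?_, s * y, ?_, ?_⟩
  · rw [hcenter, map_mul, ← ha, map_mul, map_mul, hvs, hvt, one_mul, one_mul]
    exact hw1
  · rw [hcenter, map_mul, ← hy, map_mul, map_mul, hvs, hvt, one_mul, one_mul, hwx]
    exact lt_irrefl _
  · rw [Algebra.smul_def, map_mul, map_mul, ← ha, ← hy]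
    ring

/-! ### Descending chains in modules of p-power torsion -/

theorem isArtinian_of_pow_maximalIdeal_smul_eq_zero {R T : Type*} [CommRing R] [IsLocalRing R]
    [IsNoetherianRing R] [AddCommGroup T] [Module R T] [Module.Finite R T] (n : ℕ)
    (h : ∀ r ∈ IsLocalRing.maximalIdeal R ^ n, ∀ t : T, r • t = 0) : IsArtinian R T := by
  -- The exponent n + 1 keeps the ideal proper when n = 0.
  set I := IsLocalRing.maximalIdeal R ^ (n + 1)
  have hmin : IsLocalRing.maximalIdeal R ∈ I.minimalPrimes := by
    refine ⟨⟨inferInstance, Ideal.pow_le_self n.succ_ne_zero⟩, fun J hJ _ ↦ ?_⟩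
    exact (hJ.1.pow_le_iff n.succ_ne_zero).mp hJ.2
  have := IsLocalRing.quotient_artinian_of_mem_minimalPrimes_of_isLocalRing I hmin
  have htors : Module.IsTorsionBySet R T I := fun t r ↦
    h r.1 (Ideal.pow_le_pow_right n.le_succ r.2) t
  let := htors.module
  have : IsScalarTower R (R ⧸ I) T := htors.isScalarTower
  have : Module.Finite (R ⧸ I) T := Module.Finite.of_restrictScalars_finite R (R ⧸ I) T
  exact isArtinian_of_surjective_algebraMap (R := R ⧸ I) (S := R) (M := T)
    Ideal.Quotient.mk_surjective

/-- A descending chain in a finite module of `p`-power torsion stabilizes locally at `p`. -/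
theorem exists_forall_exists_smul_mem {R T : Type*} [CommRing R] [IsNoetherianRing R]
    [AddCommGroup T] [Module R T] [Module.Finite R T] (p : Ideal R) [p.IsPrime]
    (htors : ∀ t : T, ∃ e : ℕ, ∀ r ∈ p ^ e, r • t = 0)
    (N : ℕ → Submodule R T) (hN : Antitone N) :
    ∃ n, ∀ k, ∀ t ∈ N n, ∃ s ∉ p, s • t ∈ N k := by
  -- Finite generation makes the torsion exponent uniform, so the localization at p is Artinian.
  obtain ⟨E, hE⟩ : ∃ E : ℕ, ∀ r ∈ p ^ E, ∀ t : T, r • t = 0 := by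
    obtain ⟨G, hG⟩ := Module.Finite.fg_top (R := R) (M := T)
    choose e he using htors
    refine ⟨G.sup e, fun r hr t ↦ ?_⟩
    have ht : t ∈ Submodule.span R (G : Set T) := hG ▸ Submodule.mem_top
    induction ht using Submodule.span_induction with
    | mem g hg => exact he g r (Ideal.pow_le_pow_right (Finset.le_sup hg) hr)
    | zero => simp
    | add a b _ _ ha hb => rw [smul_add, ha, hb, add_zero]
    | smul c a _ ha => rw [smul_comm, ha, smul_zero]
  let f := LocalizedModule.mkLinearMap p.primeCompl T
  have hart : IsArtinian (Localization.AtPrime p) (LocalizedModule p.primeCompl T) := by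
    refine isArtinian_of_pow_maximalIdeal_smul_eq_zero E fun r hr t ↦ ?_
    rw [← Localization.AtPrime.map_eq_maximalIdeal, ← Ideal.map_pow] at hr
    induction hr using Submodule.span_induction with
    | mem r hr =>
      obtain ⟨r, hr, rfl⟩ := hr
      obtain ⟨⟨m, s⟩, rfl⟩ := IsLocalizedModule.mk'_surjective p.primeCompl f t
      simp only [Function.uncurry]
      rw [algebraMap_smul, ← IsLocalizedModule.mk'_smul, hE r hr m, IsLocalizedModule.mk'_zero]
    | zero => simp
    | add a b _ _ ha hb => rw [add_smul, ha, hb, add_zero]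
    | smul c a _ ha => rw [smul_assoc, ha, smul_zero]
  let L : ℕ →o (Submodule (Localization.AtPrime p) (LocalizedModule p.primeCompl T))ᵒᵈ :=
    { toFun k := OrderDual.toDual ((N k).localized' (Localization.AtPrime p) p.primeCompl f)
      monotone' i j hij := (Submodule.localized'gi (Localization.AtPrime p)
        p.primeCompl f).gc.monotone_l (hN hij) }
  obtain ⟨n, hn⟩ := IsArtinian.monotone_stabilizes L
  refine ⟨n, fun k t ht ↦ ?_⟩
  rcases le_total k n with hkn | hkn
  · exact ⟨1, fun h ↦ Ideal.IsPrime.ne_top ‹_› ((Ideal.eq_top_iff_one _).mpr h),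
      by simpa using hN hkn ht⟩
  have hmem : f t ∈ (N k).localized' (Localization.AtPrime p) p.primeCompl f := by
    have h1 : (N n).localized' (Localization.AtPrime p) p.primeCompl f =
      (N k).localized' (Localization.AtPrime p) p.primeCompl f := hn k hkn
    rw [← h1, Submodule.mem_localized']
    exact ⟨t, ht, 1, IsLocalizedModule.mk'_one _ _ _⟩
  obtain ⟨m, hm, s, hs⟩ := (Submodule.mem_localized' _ _ _ _ _).mp hmem
  rw [IsLocalizedModule.mk'_eq_iff, Submonoid.smul_def, ← map_smul,
    IsLocalizedModule.eq_iff_exists p.primeCompl] at hs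
  obtain ⟨c, hc⟩ := hs
  refine ⟨c * s, (c * s).2, ?_⟩
  have : ((c : R) * (s : R)) • t = (c : R) • m := by
    rw [mul_smul]; exact hc.symm
  rw [this]
  exact (N k).smul_mem _ hm

/-- Relative form of `exists_forall_exists_smul_mem`, for submodules containing a fixed `Z`. -/
theorem exists_forall_exists_smul_mem_of_le {R M : Type*} [CommRing R] [IsNoetherianRing R]
    [AddCommGroup M] [Module R M] (p : Ideal R) [p.IsPrime] (Z : Submodule R M)
    (L : ℕ → Submodule R M) (hL : Antitone L) (hZ : ∀ k, Z ≤ L k) (hfg : (L 0).FG)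
    (htors : ∀ t ∈ L 0, ∃ e : ℕ, ∀ r ∈ p ^ e, r • t ∈ Z) :
    ∃ n, ∀ k, ∀ t ∈ L n, ∃ s ∉ p, s • t ∈ L k := by
  have : Module.Finite R (L 0) := Module.Finite.iff_fg.mpr hfg
  let q := (Z.submoduleOf (L 0)).mkQ
  obtain ⟨n, hn⟩ := exists_forall_exists_smul_mem (T := L 0 ⧸ Z.submoduleOf (L 0)) p
    (fun t ↦ by
      obtain ⟨⟨t, ht⟩, rfl⟩ := Submodule.mkQ_surjective _ t
      obtain ⟨e, he⟩ := htors t ht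
      refine ⟨e, fun r hr ↦ ?_⟩
      rw [← map_smul, Submodule.mkQ_apply, Submodule.Quotient.mk_eq_zero]
      exact he r hr)
    (fun k ↦ ((L k).submoduleOf (L 0)).map q)
    (fun i j hij ↦ Submodule.map_mono (Submodule.comap_mono (hL hij)))
  refine ⟨n, fun k t ht ↦ ?_⟩
  obtain ⟨s, hs, hst⟩ := hn k (q ⟨t, hL n.zero_le ht⟩) ⟨_, ht, rfl⟩
  refine ⟨s, hs, ?_⟩
  obtain ⟨⟨l, hl0⟩, hl, hls⟩ := hst
  rw [← map_smul, ← sub_eq_zero, ← map_sub, Submodule.mkQ_apply,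
    Submodule.Quotient.mk_eq_zero] at hls
  have h1 : l - s • t ∈ Z := hls
  have h2 : l ∈ L k := hl
  have := (L k).sub_mem h2 (hZ k h1)
  rwa [sub_sub_cancel] at this

/-! ### The ring S[x] over a finite R-algebra S -/

section Transform

variable {R K : Type*} [CommRing R] [CommRing K] [Algebra R K] (S : Subalgebra R K) (x : K)

/-- The ring `S[x]`, as an `R`-submodule of `K`. -/
noncomputable def adjoinSubmodule : Submodule R K :=
  LinearMap.range ((aeval (R := S) x).toLinearMap.restrictScalars R)

/-- The `R`-submodule of values at `x` of polynomials of degree less than `n` over `S`. -/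
noncomputable def adjoinSubmoduleLT (n : ℕ) : Submodule R K :=
  ((degreeLT S n).restrictScalars R).map ((aeval (R := S) x).toLinearMap.restrictScalars R)

variable {S x}

theorem mem_adjoinSubmodule {c : K} :
    c ∈ adjoinSubmodule S x ↔ ∃ f : S[X], aeval x f = c := Iff.rfl

theorem mem_adjoinSubmoduleLT {n : ℕ} {c : K} :
    c ∈ adjoinSubmoduleLT S x n ↔ ∃ f : S[X], f.degree < n ∧ aeval x f = c := by
  simp [adjoinSubmoduleLT, mem_degreeLT]

theorem adjoinSubmoduleLT_mono {m n : ℕ} (h : m ≤ n) :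
    adjoinSubmoduleLT S x m ≤ adjoinSubmoduleLT S x n :=
  Submodule.map_mono fun _ hf ↦ degreeLT_mono h hf

theorem exists_le_adjoinSubmoduleLT {F : Submodule R K} (hF : F.FG)
    (h : F ≤ adjoinSubmodule S x) : ∃ n, F ≤ adjoinSubmoduleLT S x n := by
  obtain ⟨G, rfl⟩ := hF
  have : ∀ g ∈ G, ∃ n, g ∈ adjoinSubmoduleLT S x n := fun g hg ↦ by
    obtain ⟨f, hf⟩ := mem_adjoinSubmodule.mp (h (Submodule.subset_span hg))
    exact ⟨f.natDegree + 1, mem_adjoinSubmoduleLT.mpr ⟨f, degree_lt_iff_coeff_zero _ _ |>.mpr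
      fun m hm ↦ coeff_eq_zero_of_natDegree_lt hm, hf⟩⟩
  choose! n hn using this
  exact ⟨G.sup n, Submodule.span_le.mpr fun g hg ↦
    adjoinSubmoduleLT_mono (Finset.le_sup hg) (hn g hg)⟩

theorem exists_forall_pow_smul_mem (I : Ideal R) (hI : ∃ n : ℕ, ∀ r ∈ I ^ n, r • x ∈ S)
    {c : K} (hc : c ∈ adjoinSubmodule S x) : ∃ e : ℕ, ∀ r ∈ I ^ e, r • c ∈ S := by
  obtain ⟨n, hn⟩ := hI
  obtain ⟨f, rfl⟩ := mem_adjoinSubmodule.mp hc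
  -- Each factor x of a monomial costs I ^ n.
  have hpow : ∀ i : ℕ, ∀ r ∈ I ^ (n * i), r • x ^ i ∈ S := by
    intro i
    induction i with
    | zero => intro r _; rw [pow_zero, ← Algebra.algebraMap_eq_smul_one]; exact S.algebraMap_mem r
    | succ i ih =>
      intro r hr
      rw [mul_add_one, pow_add] at hr
      induction hr using Submodule.mul_induction_on' with
      | mem_mul_mem a ha b hb =>
        rw [pow_succ, ← smul_mul_smul_comm]
        exact S.mul_mem (ih a ha) (hn b hb)
      | add a _ b _ ha hb => rw [add_smul]; exact S.add_mem ha hb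
  refine ⟨n * f.natDegree, fun r hr ↦ ?_⟩
  rw [aeval_eq_sum_range, Finset.smul_sum]
  refine S.sum_mem fun i hi ↦ ?_
  rw [smul_comm, Algebra.smul_def]
  refine S.mul_mem (f.coeff i).2 (hpow i r (Ideal.pow_le_pow_right ?_ hr))
  exact Nat.mul_le_mul_left _ (Nat.lt_succ_iff.mp (Finset.mem_range.mp hi))

/-- If `x` is multiplied into `S` by a power of a prime `p` of the Noetherian ring `R`, then `x` is
algebraic modulo each element `d` of `p`, locally at `p`. -/
theorem exists_smul_pow_eq_add [IsNoetherianRing R] [Module.Finite R S] (p : Ideal R) [p.IsPrime]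
    {d : R} (hd : IsUnit (algebraMap R K d)) (hdx : d • x ∈ S)
    (hpx : ∃ n : ℕ, ∀ r ∈ p ^ n, r • x ∈ S) :
    ∃ (k : ℕ) (f g : S[X]), f.degree < k ∧
      ∃ s ∉ p, s • x ^ k = aeval x f + d • aeval x g := by
  set C := adjoinSubmodule S x
  have hcancel : ∀ {n : ℕ} {a b : K}, d ^ n • a = d ^ n • b → a = b := fun {n a b} h ↦ by
    rw [Algebra.smul_def, Algebra.smul_def, map_pow] at h
    exact (hd.pow n).mul_left_cancel h
  let SM : Submodule R K := Subalgebra.toSubmodule S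
  have hSN : IsNoetherian R SM := isNoetherian_of_isNoetherianRing_of_finite R S
  let μ : R → K →ₗ[R] K := fun r ↦ LinearMap.lsmul R K r
  let Z : Submodule R K := SM.map (μ d)
  -- L k = (d^(k+1) C ∩ S) + dS. The exponent starts at 1 so that L 0 / dS is p-power torsion: an
  -- element dc with c ∈ C is carried into dS as soon as c is carried into S. Hence the chain
  -- stabilizes locally at p, from some n on.
  let L : ℕ → Submodule R K := fun k ↦ (C.map (μ (d ^ (k + 1))) ⊓ SM) ⊔ Z
  have hZS : Z ≤ SM := by
    rintro _ ⟨a, ha, rfl⟩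
    exact SM.smul_mem d ha
  have hLS : ∀ k, L k ≤ SM := fun k ↦ sup_le inf_le_right hZS
  have hL : Antitone L := by
    refine antitone_nat_of_succ_le fun k ↦ sup_le_sup_right (inf_le_inf_right _ ?_) _
    rintro _ ⟨c, hc, rfl⟩
    refine ⟨d • c, C.smul_mem d hc, ?_⟩
    simp only [μ, LinearMap.lsmul_apply, smul_smul, ← pow_succ]
  have hLfg : (L 0).FG :=
    have : IsNoetherian R (L 0) := isNoetherian_of_le (hLS 0)
    Module.Finite.iff_fg.mp inferInstance
  obtain ⟨n, hn⟩ := exists_forall_exists_smul_mem_of_le p Z L hL (fun k ↦ le_sup_right)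
    hLfg (fun t ht ↦ by
      obtain ⟨_, ⟨⟨c, hc, rfl⟩, -⟩, z, hz, rfl⟩ := Submodule.mem_sup.mp ht
      obtain ⟨e, he⟩ := exists_forall_pow_smul_mem p hpx hc
      refine ⟨e, fun r hr ↦ ?_⟩
      rw [smul_add]
      refine Z.add_mem ⟨r • c, he r hr, ?_⟩ (Z.smul_mem r hz)
      simp only [μ, LinearMap.lsmul_apply, zero_add, pow_one]
      rw [smul_comm])
  -- Multiplication by d^(n+1) embeds F into the Noetherian module S. The next claim shows that F
  -- generates C modulo dC locally at p, so one degree bound k serves for F and x^k yields the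
  -- relation.
  let F : Submodule R K := C ⊓ SM.comap (μ (d ^ (n + 1)))
  have hF : F.FG := by
    have : IsNoetherian R F := by
      refine isNoetherian_of_injective (((μ (d ^ (n + 1))).domRestrict F).codRestrict SM
        fun c ↦ c.2.2) fun a b hab ↦ Subtype.ext (hcancel (n := n + 1) ?_)
      exact congrArg Subtype.val hab
    exact Module.Finite.iff_fg.mp inferInstance
  have hmain : ∀ (N : ℕ), ∀ c ∈ C, d ^ N • c ∈ S → ∃ s ∉ p, s • c ∈ F ⊔ C.map (μ d) := by
    intro N
    induction N with
    | zero =>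
      intro c hc hcS
      refine ⟨1, fun h ↦ Ideal.IsPrime.ne_top ‹_› ((Ideal.eq_top_iff_one _).mpr h), ?_⟩
      rw [one_smul]
      rw [pow_zero, one_smul] at hcS
      exact Submodule.mem_sup_left ⟨hc, SM.smul_mem _ hcS⟩
    | succ N ih =>
      intro c hc hcS
      rcases le_or_gt N n with hNn | hNn
      · refine ⟨1, fun h ↦ Ideal.IsPrime.ne_top ‹_› ((Ideal.eq_top_iff_one _).mpr h), ?_⟩
        rw [one_smul]
        refine Submodule.mem_sup_left ⟨hc, ?_⟩
        have : d ^ (n + 1) • c = d ^ (n - N) • d ^ (N + 1) • c := by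
          rw [smul_smul, ← pow_add]; congr 2; omega
        change d ^ (n + 1) • c ∈ SM
        rw [this]
        exact SM.smul_mem _ hcS
      -- Stability gives s d^(N+1) c = d^(N+2) c' + da with a ∈ S. Cancelling d leaves d^N (sc -
      -- dc') ∈ S, to which induction applies.
      · obtain ⟨s, hs, hsL⟩ := hn (N + 1) (d ^ (N + 1) • c)
          (hL hNn.le (Submodule.mem_sup_left ⟨⟨c, hc, rfl⟩, hcS⟩))
        obtain ⟨_, ⟨⟨c', hc', rfl⟩, -⟩, _, ⟨a, ha, rfl⟩, hsum⟩ := Submodule.mem_sup.mp hsL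
        simp only [μ, LinearMap.lsmul_apply] at hsum
        have hred : d ^ N • (s • c - d • c') = a := by
          refine hcancel (n := 1) ?_
          rw [pow_one, ← eq_sub_iff_add_eq'] at *
          rw [hsum]
          simp only [Algebra.smul_def, map_pow]
          ring
        obtain ⟨s', hs', h⟩ := ih (s • c - d • c') (C.sub_mem (C.smul_mem _ hc) (C.smul_mem _ hc'))
          (hred ▸ ha)
        refine ⟨s' * s, fun h ↦ (Ideal.IsPrime.mem_or_mem ‹_› h).elim hs' hs, ?_⟩
        have : (s' * s) • c = s' • (s • c - d • c') + d • (s' • c') := by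
          simp only [Algebra.smul_def, map_mul]
          ring
        rw [this]
        exact Submodule.add_mem _ h (Submodule.mem_sup_right ⟨s' • c', C.smul_mem _ hc', rfl⟩)
  obtain ⟨k, hk⟩ := exists_le_adjoinSubmoduleLT hF inf_le_left
  obtain ⟨s, hs, h⟩ := hmain k (x ^ k) (mem_adjoinSubmodule.mpr ⟨X ^ k, by simp⟩) (by
    rw [← _root_.smul_pow]; exact S.pow_mem hdx k)
  obtain ⟨a, ha, _, ⟨c, hc, rfl⟩, hsum⟩ := Submodule.mem_sup.mp h
  obtain ⟨f, hf, rfl⟩ := mem_adjoinSubmoduleLT.mp (hk ha)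
  obtain ⟨g, rfl⟩ := mem_adjoinSubmodule.mp hc
  exact ⟨k, f, g, hf, s, hs, hsum.symm⟩

end Transform

/-! ### Denominator ideals in the integral closure -/

/-- In A_Q the radical of I is the maximal ideal, so it contains J, and a power of the finitely
generated J falls into I; the denominators of finitely many generators combine into one s. -/
theorem exists_smul_pow_le_of_mem_minimalPrimes {A : Type*} [CommRing A] {I Q : Ideal A}
    (hQ : Q ∈ I.minimalPrimes) {J : Ideal A} (hJ : J.FG) (hJQ : J ≤ Q) :
    ∃ s ∉ Q, ∃ n : ℕ, ∀ r ∈ J ^ n, s * r ∈ I := by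
  have hQp : Q.IsPrime := hQ.1.1
  let A' := Localization.AtPrime Q
  have hrad := IsLocalization.AtPrime.radical_map_of_mem_minimalPrimes (A := A') Q I hQ
  obtain ⟨n, hn⟩ := Ideal.exists_pow_le_of_le_radical_of_fg
    (I := J) (J := (I.map (algebraMap A A')).comap (algebraMap A A')) (by
      rw [← Ideal.comap_radical, hrad]
      exact hJQ.trans Ideal.le_comap_map) hJ
  obtain ⟨G, hG⟩ := hJ.pow (n := n)
  have : ∀ g ∈ G, ∃ s ∉ Q, s * g ∈ I := fun g hg ↦ by
    have h1 : algebraMap A A' g ∈ I.map (algebraMap A A') := by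
      refine hn ?_
      rw [← hG]
      exact Submodule.subset_span hg
    obtain ⟨s, hs, h⟩ :=
      (IsLocalization.algebraMap_mem_map_algebraMap_iff Q.primeCompl A' I g).mp h1
    exact ⟨s, hs, h⟩
  choose! s hs hsg using this
  classical
  refine ⟨∏ g ∈ G, s g, fun h ↦ ?_, n, fun r hr ↦ ?_⟩
  · obtain ⟨g, hg, h⟩ := hQp.prod_mem_iff.mp h
    exact hs g hg h
  · have hle : J ^ n ≤ Submodule.comap (LinearMap.mulLeft A (∏ g ∈ G, s g)) I := by
      rw [← hG, Submodule.span_le]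
      intro g hg
      change (∏ g ∈ G, s g) * g ∈ I
      rw [← Finset.prod_erase_mul _ _ hg, mul_assoc]
      exact I.mul_mem_left _ (hsg g hg)
    exact hle hr

/-- The ideal of elements of `A` multiplying `x` into `A`. -/
def denominatorIdeal (A : Type*) {K : Type*} [CommRing A] [CommRing K] [Algebra A K] (x : K) :
    Ideal A :=
  (LinearMap.range (Algebra.linearMap A K)).comap (LinearMap.toSpanSingleton A K x)

theorem mem_denominatorIdeal {A K : Type*} [CommRing A] [CommRing K] [Algebra A K] {x : K} {a : A} :
    a ∈ denominatorIdeal A x ↔ ∃ y, a • x = algebraMap A K y := by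
  simp [denominatorIdeal, eq_comm]

section Noetherian

variable {R A K : Type*} [CommRing R] [CommRing A] [CommRing K] [Algebra R A] [Algebra A K]
  [Algebra R K] [IsScalarTower R A K]

/-- Let `A` be integral over a Noetherian ring `R` and integrally closed in `K`. At a minimal prime
`Q` of the denominator ideal of `x`, some multiple of `x` lies in `A` but not in `Q`. -/
theorem exists_smul_eq_notMem [IsNoetherianRing R] [Algebra.IsIntegral R A]
    [IsIntegrallyClosedIn A K] {x : K} {d : R} (hd : IsUnit (algebraMap R K d))
    (hdx : algebraMap R A d ∈ denominatorIdeal A x) {Q : Ideal A}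
    (hQ : Q ∈ (denominatorIdeal A x).minimalPrimes) :
    ∃ a : A, ∃ y ∉ Q, a • x = algebraMap A K y := by
  have hQp : Q.IsPrime := hQ.1.1
  have hinj : Function.Injective (algebraMap A K) := (isIntegrallyClosedIn_iff.mp ‹_›).1
  by_contra! hcon
  -- A need not be Noetherian, so the finitely generated extension of p = Q ∩ R stands in for Q: s
  -- p^n x ⊆ A.
  obtain ⟨s, hsQ, n, hs⟩ := exists_smul_pow_le_of_mem_minimalPrimes hQ
    (Ideal.FG.map (IsNoetherian.noetherian (Q.under R)) (algebraMap R A)) Ideal.map_comap_le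
  obtain ⟨G, hG⟩ := IsNoetherian.noetherian (Q.under R ^ n)
  have hintegral : ∀ r : R, (∃ y : A, r • s • x = algebraMap A K y) → IsIntegral R (r • s • x) := by
    rintro r ⟨y, hy⟩
    rw [hy]
    exact (Algebra.IsIntegral.isIntegral (R := R) y).algebraMap
  have hp : ∀ r ∈ Q.under R ^ n, ∃ y : A, r • s • x = algebraMap A K y := by
    intro r hr
    have h1 : algebraMap R A r ∈ (Q.under R).map (algebraMap R A) ^ n := by
      rw [← Ideal.map_pow]
      exact Ideal.mem_map_of_mem _ hr
    obtain ⟨y, hy⟩ := mem_denominatorIdeal.mp (hs _ h1)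
    exact ⟨y, by rw [← hy, mul_comm, mul_smul, algebraMap_smul]⟩
  have hds : ∃ y : A, d • s • x = algebraMap A K y := by
    obtain ⟨y, hy⟩ := mem_denominatorIdeal.mp hdx
    refine ⟨s * y, ?_⟩
    rw [map_mul, ← hy, algebraMap_smul, smul_comm, Algebra.smul_def]
  classical
  let E : Finset R := insert d G
  -- Adjoining dsx and the multiples of sx by generators of p^n, all integral over R, gives an
  -- R-finite S inside A with p^n sx ⊆ S.
  let S : Subalgebra R K := Algebra.adjoin R ((fun r : R ↦ r • s • x) '' (E : Set R))
  have hE : ∀ r ∈ E, ∃ y : A, r • s • x = algebraMap A K y := by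
    intro r hr
    rcases Finset.mem_insert.mp hr with rfl | hr
    · exact hds
    · exact hp r (hG ▸ Submodule.subset_span hr)
  have hSfin : Module.Finite R S := by
    refine Module.Finite.iff_fg.mpr (fg_adjoin_of_finite (E.finite_toSet.image _) ?_)
    rintro _ ⟨r, hr, rfl⟩
    exact hintegral r (hE r hr)
  have hSA : S ≤ (IsScalarTower.toAlgHom R A K).range := by
    refine Algebra.adjoin_le ?_
    rintro _ ⟨r, hr, rfl⟩
    obtain ⟨y, hy⟩ := hE r hr
    exact ⟨y, hy.symm⟩
  have hSG : ∀ r ∈ E, r • s • x ∈ S := fun r hr ↦ Algebra.subset_adjoin ⟨r, hr, rfl⟩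
  obtain ⟨k, f, g, hf, t, ht, hk⟩ := exists_smul_pow_eq_add (S := S) (x := s • x) (Q.under R) hd
    (hSG d (Finset.mem_insert_self _ _)) ⟨n, fun r hr ↦ by
      have hle : Q.under R ^ n ≤ (Subalgebra.toSubmodule S).comap
          (LinearMap.toSpanSingleton R K (s • x)) := by
        rw [← hG, Submodule.span_le]
        exact fun g hg ↦ hSG g (Finset.mem_insert_of_mem hg)
      exact hle hr⟩
  have hlift : ∀ f : S[X], ∃ f' : A[X],
      f'.map (algebraMap A K) = f.map (algebraMap S K) := by
    intro f
    rw [← mem_lifts, lifts_iff_coeff_lifts]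
    intro i
    rw [coeff_map]
    exact hSA (f.coeff i).2
  obtain ⟨f', hf'⟩ := hlift f
  obtain ⟨g', hg'⟩ := hlift g
  have hdQ : algebraMap R A d ∈ Q := hQ.1.2 hdx
  -- The polynomial t X^k - f' - d g' vanishes at sx, and deg f < k, so its k-th coefficient is t -
  -- d g'_k. As d ∈ Q, this would force t ∈ Q.
  have hmem := coeff_mem_of_aeval_eq_zero (Q := Q) (x := s • x)
    (f := C (algebraMap R A t) * X ^ k - f' - C (algebraMap R A d) * g') (fun a y hay ↦ by
      rw [smul_smul] at hay
      refine ⟨?_, ?_⟩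
      · exact (hQp.mem_or_mem (hQ.1.2 (mem_denominatorIdeal.mpr ⟨y, hay⟩))).resolve_right hsQ
      · by_contra hy
        exact hcon _ y hy hay) (by
    have h1 : ∀ f : S[X], ∀ f' : A[X], f'.map (algebraMap A K) = f.map (algebraMap S K) →
        aeval (s • x) f' = aeval (s • x) f := fun f f' h ↦ by
      rw [aeval_def, aeval_def, ← eval_map, ← eval_map, h]
    simp only [map_sub, map_mul, aeval_C, map_pow, aeval_X, h1 f f' hf', h1 g g' hg',
      ← IsScalarTower.algebraMap_apply R A K, ← Algebra.smul_def, hk]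
    ring) k
  have hfk : f'.coeff k = 0 := by
    apply hinj
    rw [← coeff_map, hf', coeff_map, coeff_eq_zero_of_degree_lt hf, map_zero, map_zero]
  rw [coeff_sub, coeff_sub, coeff_C_mul, coeff_X_pow_self, mul_one, hfk, sub_zero,
    coeff_C_mul] at hmem
  refine ht ?_
  rw [Ideal.mem_comap]
  have := Q.add_mem hmem (Q.mul_mem_right (g'.coeff k) hdQ)
  rwa [sub_add_cancel] at this

end Noetherian

/-! ### The integral closure in the total quotient ring -/

theorem isFractionRing_integralClosure (R K : Type*) [CommRing R] [CommRing K] [Algebra R K]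
    [IsFractionRing R K] : IsFractionRing (integralClosure R K) K := by
  refine (isLocalization_iff _ _).mpr ⟨?_, ?_, ?_⟩
  · rintro ⟨a, ha⟩
    obtain ⟨r, s, hrs⟩ := IsLocalization.exists_mk'_eq R⁰ (a : K)
    have hsu := IsLocalization.map_units K s
    have hspec : (a : K) * algebraMap R K s = algebraMap R K r := by
      rw [← hrs]; exact IsLocalization.mk'_spec _ _ _
    -- For a = r/s regular in the closure, zr = 0 gives za = 0, so the numerator r is regular and a
    -- is a unit of K.
    have hr : r ∈ R⁰ := by
      rw [mem_nonZeroDivisors_iff_right]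
      intro z hz
      have h1 : algebraMap R (integralClosure R K) z * a = 0 := by
        refine Subtype.ext (hsu.mul_right_cancel ?_)
        change algebraMap R K z * (a : K) * algebraMap R K s = 0 * _
        rw [mul_assoc, hspec, ← map_mul, hz, map_zero, zero_mul]
      have h2 := (mem_nonZeroDivisors_iff_right.mp ha) _ h1
      apply IsFractionRing.injective R K
      rw [map_zero]
      exact congrArg Subtype.val h2
    have hru := IsLocalization.map_units K (⟨r, hr⟩ : R⁰)
    have : IsUnit ((a : K) * algebraMap R K s) := by rw [hspec]; exact hru
    exact isUnit_of_mul_isUnit_left this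
  · intro z
    obtain ⟨r, s, rfl⟩ := IsLocalization.exists_mk'_eq R⁰ z
    refine ⟨⟨algebraMap R _ r, ⟨algebraMap R _ s, ?_⟩⟩, IsLocalization.mk'_spec K r s⟩
    rw [mem_nonZeroDivisors_iff_right]
    intro w hw
    refine Subtype.ext ((IsLocalization.map_units K s).mul_right_cancel ?_)
    rw [ZeroMemClass.coe_zero, zero_mul]
    exact congrArg Subtype.val hw
  · intro a b hab
    exact ⟨1, by rw [Subtype.ext hab]⟩

theorem isPerinormal_integralClosure (R K : Type*) [CommRing R] [IsNoetherianRing R] [CommRing K]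
    [Algebra R K] [IsFractionRing R K] : IsPerinormal (integralClosure R K) := by
  set A := integralClosure R K
  have hfrac : IsFractionRing A K := isFractionRing_integralClosure R K
  let e : FractionRing A ≃ₐ[A] K := FractionRing.algEquiv A K
  have hclosed : IsIntegrallyClosedIn A (FractionRing A) :=
    e.isIntegrallyClosedIn.mpr inferInstance
  refine isPerinormal_of_forall_exists fun P _ x hx ↦ ?_
  obtain ⟨r, d, hrd⟩ := IsLocalization.exists_mk'_eq R⁰ (e x)
  have hspec : algebraMap R K d * e x = algebraMap R K r := by
    rw [← hrd, mul_comm]; exact IsLocalization.mk'_spec _ _ _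
  have hd : IsUnit (algebraMap R (FractionRing A) d) := by
    have h1 : e (algebraMap R (FractionRing A) d) = algebraMap R K d := by
      rw [IsScalarTower.algebraMap_apply R A (FractionRing A), e.commutes]
      rfl
    rw [← isUnit_map_iff e, h1]
    exact IsLocalization.map_units K d
  have hdx : algebraMap R A d ∈ denominatorIdeal A x := by
    refine mem_denominatorIdeal.mpr ⟨algebraMap R A r, e.injective ?_⟩
    rw [map_smul, e.commutes, Algebra.smul_def]
    exact hspec
  obtain ⟨Q, hQ, hQP⟩ := Ideal.exists_minimalPrimes_le (I := denominatorIdeal A x) (J := P)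
    fun s hs ↦ (mem_denominatorIdeal.mp hs).elim fun a ha ↦ hx s a ha
  obtain ⟨a, y, hy, hay⟩ := exists_smul_eq_notMem hd hdx hQ
  exact ⟨Q, hQ.1.1, hQP, a, hQ.1.2 (mem_denominatorIdeal.mpr ⟨y, hay⟩), y, hy, hay⟩

end ZeroDivisorRing

theorem corollary20 :
    (∀ (A : Type*) [CommRing A],
      ZeroDivisorRing.IsMarotRing A → ZeroDivisorRing.IsKrullRing A →
        ZeroDivisorRing.IsPerinormal A) ∧
    (∀ (R : Type*) [CommRing R] [IsNoetherianRing R]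
      (K : Type*) [CommRing K] [Algebra R K] [IsFractionRing R K],
        ZeroDivisorRing.IsPerinormal (integralClosure R K)) :=
  ⟨fun _ _ hM hK ↦ hK.isPerinormal hM,
    fun R _ _ K _ _ _ ↦ ZeroDivisorRing.isPerinormal_integralClosure R K⟩
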